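/- A rational two-flat zonotope in $\mathbb{R}^3$ is a set of the form $$P = \mathbf{c} + [\mathbf{0},\mathbf{v}_1] + \cdots + [\mathbf{0},\mathbf{v}_n] + [\mathbf{0},\mathbf{w}_1] + \cdots + [\mathbf{0},\mathbf{w}_m]$$ (a translate of a Minkowski sum of line segments), where $\mathbf{c} \in \mathbb{R}^3$, the vectors $\mathbf{v}_i, \mathbf{w}_j$ have rational coordinates, and there are two different two-dimensional linear subspaces $H_1, H_2$ of $\mathbb{R}^3$ with $\mathbf{v}_1,\ldots,\mathbf{v}_n \in H_1$ and $\mathbf{w}_1,\ldots,\mathbf{w}_m \in H_2$. For an integer $k \ge 1$ and a set $\Lambda \subseteq \mathbb{R}^3$ with only finitely many points in every ball, $P$ is said to $k$-tile with $\Lambda$ if $$\sum_{\lambda\in\Lambda} \mathbf{1}_{P+\lambda}(x) = k \quad\text{for almost every } x \in \mathbb{R}^3 .$$ Corollary. Let $P \subseteq \mathbb{R}^3$ be a rational two-flat zonotope with nonempty interior. Then there are an integer $k \ge 1$ and a set $\Lambda \subseteq \mathbb{R}^3$, with only finitely many points in every ball, such that $P$ $k$-tiles with $\Lambda$, but $\Lambda$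 is not a finite union of translated lattices. Here a lattice is a discrete additive subgroup of $\mathbb{R}^3$ of any rank, and the lattices in a union may have different ranks. -/

import Mathlib

open MeasureTheory
open scoped Pointwise ENNReal

/-- Euclidean three-space. -/
abbrev E3 : Type := EuclideanSpace ℝ (Fin 3)

/-- The zonotope `c + [0, v 1] + ⋯ + [0, v n]`, a translate of a Minkowski sum of segments. -/
def zonotope {n : ℕ} (c : E3) (v : Fin n → E3) : Set E3 :=
  c +ᵥ ∑ i, segment ℝ 0 (v i)

/-- A vector all of whose coordinates are rational. -/
def IsRationalVector (v : E3) : Prop :=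
  ∀ i : Fin 3, ∃ q : ℚ, v i = (q : ℝ)

/-- `P` is a translate of the Minkowski sum of finitely many segments with rational direction
vectors, the first `n` of them in a plane `H₁` and the other `m` in a plane `H₂`, where `H₁`, `H₂`
are two different two-dimensional linear subspaces.  (A segment in `H₁ ∩ H₂` may be counted in
either plane, or be split between them.) -/
def IsRationalTwoFlatZonotope (P : Set E3) : Prop :=
  ∃ H₁ H₂ : Submodule ℝ E3,
    Module.finrank ℝ H₁ = 2 ∧ Module.finrank ℝ H₂ = 2 ∧ H₁ ≠ H₂ ∧
    ∃ (n m : ℕ) (v : Fin n → E3) (w : Fin m → E3) (c : E3),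
      (∀ i, v i ∈ H₁) ∧ (∀ j, w j ∈ H₂) ∧
      (∀ i, IsRationalVector (v i)) ∧ (∀ j, IsRationalVector (w j)) ∧
      P = zonotope c (Fin.append v w)

/-- A set of points of which every ball contains only finitely many. -/
def IsDiscreteSet (Λ : Set E3) : Prop :=
  ∀ (x : E3) (r : ℝ), (Λ ∩ Metric.closedBall x r).Finite

/-- `P` tiles space at level `k` by translations with the discrete set `Λ`: almost every point
lies in exactly `k` of the translates `l + P`, `l ∈ Λ`. -/
def IsTilingAtLevel (k : ℕ) (P Λ : Set E3) : Prop :=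
  IsDiscreteSet Λ ∧
    ∀ᵐ x ∂(volume : Measure E3),
      ∑' l : Λ, ((l : E3) +ᵥ P).indicator (fun _ => (1 : ℝ≥0∞)) x = (k : ℝ≥0∞)

/-- `Λ` is a union of finitely many translates of lattices.  A lattice is a discrete additive
subgroup; its dimension may be anything from `0` to `3`, and the lattices may have different
dimensions. -/
def IsFiniteUnionOfTranslatedLattices (Λ : Set E3) : Prop :=
  ∃ (N : ℕ) (L : Fin N → AddSubgroup E3) (t : Fin N → E3),
    (∀ i, DiscreteTopology (L i)) ∧ Λ = ⋃ i, t i +ᵥ (L i : Set E3)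

/-!
Write `P = c + ∑ [0, v i] + ∑ [0, w j]` with `v i ∈ H₁` and `w j ∈ H₂`.  The level-`k` tiling set is
a lattice `G` in which one planar sublattice `S = G ∩ H₁` has been translated by a vector `u ∈ H₁`.

Everything rests on one observation about covering counts, `coverCount S K x`, the number of
translates `l + K`, `l ∈ S`, that contain `x`.  For a bounded convex set `K`, each line in direction
`v` meets `(K + [0, v]) \ K` either not at all or in a half-open interval of length `v`.  Hence, if
the subgroup `S` contains `v`, adding the segment `[0, v]` to `K` adds to the covering count a
function that is invariant under `S` and under all real multiples of `v`
(`coverCount_add_segment_diff_add_smul`).  There are two consequences.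

* If a countable subgroup `G` contains all generators of a zonotope, the translates of the zonotope
  by `G` cover almost every point equally often (`exists_coverCount_zonotope_ae_eq_const`): by
  induction the count is invariant along each generator.
* Suppose that `S` contains all `v i` and that `u` lies in `S + ℝ (v i)` for every nonzero `v i`.
  The set `c + ∑ [0, w j]` is null, being contained in a translate of `H₂`, and adding the segments
  `[0, v i]` to it one at a time shows that the covering count of `P` by `S` is almost everywhere
  invariant under `u` (`coverCount_add_sum_segment_add_ae_eq`).  So `S` may be replaced by `u + S`
  in a tiling.

Rationality provides a lattice `G` containing all generators, and a vector `u ∈ H₁` outside `G`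
that satisfies the second condition for `S = G ∩ H₁` (`exists_lattice_forall_sub_smul_mem`).
Then `Λ = (G \ S) ∪ (u + S)` is again a tiling set.  For a generator `w j ∉ H₁`, all nonzero
multiples of `w j` belong to `Λ`, but `0` does not, which is impossible for a finite union of cosets
of subgroups (`zero_mem_iUnion_vadd_of_forall_zsmul_mem`).
-/

/-! ### Counting the translates that cover a point -/

section CoverCount

variable {E : Type*} [AddCommGroup E]

/-- The number of translates `l + K`, `l ∈ Λ`, that contain the point `x`. -/
noncomputable def coverCount (Λ K : Set E) (x : E) : ℝ≥0∞ :=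
  ∑' l : Λ, ((l : E) +ᵥ K).indicator (fun _ => (1 : ℝ≥0∞)) x

theorem mem_vadd_set_iff_sub_mem {K : Set E} {l x : E} : x ∈ l +ᵥ K ↔ x - l ∈ K := by
  rw [Set.mem_vadd_set_iff_neg_vadd_mem, vadd_eq_add, neg_add_eq_sub]

theorem coverCount_eq_encard (Λ K : Set E) (x : E) :
    coverCount Λ K x = ({l | l ∈ Λ ∧ x - l ∈ K}.encard : ℝ≥0∞) := by
  classical
  rw [coverCount, tsum_subtype Λ (fun l => (l +ᵥ K).indicator (fun _ => (1 : ℝ≥0∞)) x),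
    ← ENNReal.tsum_set_one, tsum_subtype _ (fun _ : E => (1 : ℝ≥0∞))]
  congr 1
  ext l
  simp only [Set.indicator_apply, mem_vadd_set_iff_sub_mem, Set.mem_ofPred_eq]
  split_ifs <;> simp_all

theorem coverCount_union {Λ₁ Λ₂ : Set E} (h : Disjoint Λ₁ Λ₂) (K : Set E) (x : E) :
    coverCount (Λ₁ ∪ Λ₂) K x = coverCount Λ₁ K x + coverCount Λ₂ K x :=
  ENNReal.summable.tsum_union_disjoint
    (f := fun l : E => (l +ᵥ K).indicator (fun _ => (1 : ℝ≥0∞)) x) h ENNReal.summable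

theorem coverCount_union_right (Λ : Set E) {K₁ K₂ : Set E} (h : Disjoint K₁ K₂) (x : E) :
    coverCount Λ (K₁ ∪ K₂) x = coverCount Λ K₁ x + coverCount Λ K₂ x := by
  simp only [coverCount]
  rw [← ENNReal.tsum_add]
  congr 1
  ext l
  rw [Set.vadd_set_union, Set.indicator_union_of_disjoint]
  exact Set.disjoint_image_of_injective (add_right_injective _) h

theorem coverCount_vadd (u : E) (Λ K : Set E) (x : E) :
    coverCount (u +ᵥ Λ) K x = coverCount Λ K (x - u) := by
  rw [coverCount_eq_encard, coverCount_eq_encard, ← Set.encard_vadd_set u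
    {l | l ∈ Λ ∧ x - u - l ∈ K}]
  congr 2
  ext l
  simp only [Set.mem_ofPred_eq, mem_vadd_set_iff_sub_mem]
  rw [show x - u - (l - u) = x - l by abel]

theorem coverCount_add_of_mem (S : AddSubgroup E) (K : Set E) {g : E} (hg : g ∈ S) (x : E) :
    coverCount S K (x + g) = coverCount S K x := by
  have h := coverCount_vadd (-g) (S : Set E) K x
  have h' : (-g) +ᵥ (S : Set E) = S := by
    ext y
    rw [mem_vadd_set_iff_sub_mem, sub_neg_eq_add]
    exact S.add_mem_cancel_right hg
  rw [h', sub_neg_eq_add] at h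
  exact h.symm

end CoverCount

/-! ### Thickening a convex set by a segment -/

section Segment

variable {E : Type*} [NormedAddCommGroup E] [NormedSpace ℝ E]

theorem mem_add_segment_zero {K : Set E} {v x : E} :
    x ∈ K + segment ℝ 0 v ↔ ∃ k ∈ K, ∃ a : ℝ, 0 ≤ a ∧ a ≤ 1 ∧ x = k + a • v := by
  rw [Set.mem_add]
  constructor
  · rintro ⟨k, hk, y, hy, rfl⟩
    rw [segment_eq_image'] at hy
    obtain ⟨a, ⟨h0, h1⟩, rfl⟩ := hy
    exact ⟨k, hk, a, h0, h1, by simp⟩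
  · rintro ⟨k, hk, a, h0, h1, rfl⟩
    refine ⟨k, hk, a • v, ?_, rfl⟩
    rw [segment_eq_image']
    exact ⟨a, ⟨h0, h1⟩, by simp⟩

theorem subset_add_segment_zero (K : Set E) (v : E) : K ⊆ K + segment ℝ 0 v := fun k hk =>
  mem_add_segment_zero.2 ⟨k, hk, 0, le_rfl, zero_le_one, by simp⟩

/-- A line in direction `v` meets `(K + [0, v]) \ K` in at most one point of each class
modulo `v`. -/
theorem Convex.eq_of_mem_add_segment_diff {K : Set E} (hK : Convex ℝ K) {v d : E} {n : ℤ}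
    (hd : d ∈ (K + segment ℝ 0 v) \ K) (hdn : d + (n : ℝ) • v ∈ (K + segment ℝ 0 v) \ K) :
    n = 0 := by
  -- Up to exchanging the two points, `n` is positive.
  wlog hn : 0 < n generalizing d n
  · by_contra hne
    have h := @this (d + (n : ℝ) • v) (-n) hdn (by simp [hd]) (by omega)
    omega
  exfalso
  obtain ⟨k, hk, a, ha0, -, rfl⟩ := mem_add_segment_zero.1 hd.1
  obtain ⟨k', hk', a', -, ha1, he⟩ := mem_add_segment_zero.1 hdn.1
  have hn' : (1 : ℝ) ≤ n := by exact_mod_cast hn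
  -- The first point lies on the segment from `k` to `k' = k + (a + n - a') v`.
  have hk'' : k' = k + (a + n - a') • v := by
    rw [eq_sub_of_add_eq he.symm]
    module
  refine hd.2 ?_
  rcases ha0.eq_or_lt with h0 | h0
  · simpa [← h0] using hk
  have hpos : 0 < a + n - a' := by linarith
  have := hK.add_smul_sub_mem hk hk' (t := a / (a + n - a'))
    ⟨by positivity, (div_le_one hpos).2 (by linarith)⟩
  rwa [hk'', add_sub_cancel_left, smul_smul, div_mul_cancel₀ _ hpos.ne'] at this

/-- A line in direction `v` that meets `(K + [0, v]) \ K` meets it in every class modulo `v`,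
provided `K` is bounded. -/
theorem Bornology.IsBounded.exists_mem_add_segment_diff {K : Set E} (hK : Bornology.IsBounded K)
    {v d : E} (hd : d ∈ (K + segment ℝ 0 v) \ K) (t : ℝ) :
    ∃ n : ℤ, d + t • v + (n : ℝ) • v ∈ (K + segment ℝ 0 v) \ K := by
  rcases eq_or_ne v 0 with rfl | hv
  · simp at hd
  obtain ⟨k, hk, a, -, -, rfl⟩ := mem_add_segment_zero.1 hd.1
  obtain ⟨C, hC⟩ := hK.exists_norm_le
  have hv' : 0 < ‖v‖ := norm_pos_iff.2 hv
  have hbound : ∀ r : ℝ, k + r • v ∈ K → r ≤ (C + ‖k‖) / ‖v‖ := by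
    intro r hr
    rw [le_div_iff₀ hv']
    calc r * ‖v‖ ≤ |r| * ‖v‖ := by gcongr; exact le_abs_self r
      _ = ‖(k + r • v) - k‖ := by rw [add_sub_cancel_left, norm_smul, Real.norm_eq_abs]
      _ ≤ ‖k + r • v‖ + ‖k‖ := norm_sub_le _ _
      _ ≤ C + ‖k‖ := by gcongr; exact hC _ hr
  -- The last integer step that is not yet beyond every point of `K` on the line.
  obtain ⟨n, ⟨r, hrK, hnr⟩, hmax⟩ := Int.exists_greatest_of_bdd
    (P := fun n : ℤ => ∃ r : ℝ, k + r • v ∈ K ∧ a + t + n ≤ r)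
    ⟨⌊(C + ‖k‖) / ‖v‖ - (a + t)⌋, fun n ⟨r, hr, hnr⟩ =>
      Int.le_floor.2 (by linarith [hbound r hr])⟩
    ⟨⌊-(a + t)⌋, 0, by simpa using hk, by linarith [Int.floor_le (-(a + t))]⟩
  have hlast : ∀ r : ℝ, k + r • v ∈ K → r < a + t + n + 1 := by
    intro r hr
    by_contra! h
    have := hmax (n + 1) ⟨r, hr, by push_cast; linarith⟩
    omega
  have he : k + a • v + t • v + ((n + 1 : ℤ) : ℝ) • v = k + (a + t + n + 1) • v := by
    push_cast
    module
  refine ⟨n + 1, ?_, fun h => ?_⟩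
  · refine mem_add_segment_zero.2 ⟨_, hrK, a + t + n + 1 - r, ?_, by linarith, ?_⟩
    · linarith [hlast r hrK]
    · rw [he]
      module
  · rw [he] at h
    exact lt_irrefl _ (hlast _ h)

/-- The part added to a bounded convex set by a segment `[0, v]` is, on each line in direction
`v`, empty or a half-open interval of length `v`; so its translates by a subgroup that contains
`v` cover every line in direction `v` evenly. -/
theorem coverCount_add_segment_diff_add_smul (S : AddSubgroup E) {K : Set E} (hK : Convex ℝ K)
    (hb : Bornology.IsBounded K) {v : E} (hv : v ∈ S) (t : ℝ) (x : E) :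
    coverCount S ((K + segment ℝ 0 v) \ K) (x + t • v)
      = coverCount S ((K + segment ℝ 0 v) \ K) x := by
  have hzv : ∀ n : ℤ, (n : ℝ) • v ∈ S := fun n => by
    rw [Int.cast_smul_eq_zsmul]
    exact S.zsmul_mem hv n
  have key : ∀ (t : ℝ) (x : E), coverCount S ((K + segment ℝ 0 v) \ K) x
      ≤ coverCount S ((K + segment ℝ 0 v) \ K) (x + t • v) := by
    intro t x
    rw [coverCount_eq_encard, coverCount_eq_encard]
    have hex : ∀ l : E, ∃ n : ℤ, x - l ∈ (K + segment ℝ 0 v) \ K →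
        x - l + t • v + (n : ℝ) • v ∈ (K + segment ℝ 0 v) \ K := by
      intro l
      by_cases h : x - l ∈ (K + segment ℝ 0 v) \ K
      · obtain ⟨n, hn⟩ := hb.exists_mem_add_segment_diff h t
        exact ⟨n, fun _ => hn⟩
      · exact ⟨0, fun h' => absurd h' h⟩
    choose n hn using hex
    have hle : {l | l ∈ (S : Set E) ∧ x - l ∈ (K + segment ℝ 0 v) \ K}.encard
        ≤ {l | l ∈ (S : Set E) ∧ x + t • v - l ∈ (K + segment ℝ 0 v) \ K}.encard := by
      refine Set.encard_le_encard_of_injOn (f := fun l => l - (n l : ℝ) • v) ?_ ?_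
      · rintro l ⟨hl, hxl⟩
        refine ⟨S.sub_mem hl (hzv _), ?_⟩
        have := hn l hxl
        rwa [show x - l + t • v + (n l : ℝ) • v = x + t • v - (l - (n l : ℝ) • v) by abel] at this
      · rintro l ⟨hl, hxl⟩ l' ⟨hl', hxl'⟩ (h : l - (n l : ℝ) • v = l' - (n l' : ℝ) • v)
        have hll : x - l' = x - l + ((n l - n l' : ℤ) : ℝ) • v := by
          rw [sub_eq_sub_iff_add_eq_add] at h
          rw [← sub_eq_zero] at h ⊢
          rw [← h]
          push_cast
          module
        rw [hll] at hxl'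
        have h0 := hK.eq_of_mem_add_segment_diff hxl hxl'
        rw [h0] at hll
        simpa using hll.symm
    exact_mod_cast hle
  refine le_antisymm ?_ (key t x)
  simpa [add_assoc] using key (-t) (x + t • v)

/-- Adding a segment `[0, v]` to a bounded convex set keeps every symmetry of its covering count
that agrees, modulo the subgroup, with a multiple of `v`. -/
theorem coverCount_add_segment_add (S : AddSubgroup E) {K : Set E} (hK : Convex ℝ K)
    (hb : Bornology.IsBounded K) {v u : E} (hv : v ∈ S) {t : ℝ} (hu : u - t • v ∈ S) {x : E}
    (hx : coverCount S K (x + u) = coverCount S K x) :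
    coverCount S (K + segment ℝ 0 v) (x + u) = coverCount S (K + segment ℝ 0 v) x := by
  have hsplit : K + segment ℝ 0 v = K ∪ ((K + segment ℝ 0 v) \ K) :=
    (Set.union_sdiff_cancel (subset_add_segment_zero K v)).symm
  rw [hsplit, coverCount_union_right _ Set.disjoint_sdiff_right,
    coverCount_union_right _ Set.disjoint_sdiff_right, hx]
  congr 1
  rw [← coverCount_add_segment_diff_add_smul S hK hb hv t x,
    ← coverCount_add_of_mem S _ hu (x + t • v)]
  congr 1
  abel

variable {ι : Type*}

theorem isCompact_add_sum_segment {A : Set E} (hA : IsCompact A) (s : Finset ι) (v : ι → E) :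
    IsCompact (A + ∑ i ∈ s, segment ℝ 0 (v i)) := by
  classical
  induction s using Finset.induction_on with
  | empty => simpa using hA
  | insert i s hi ih =>
    rw [Finset.sum_insert hi, add_comm (segment ℝ 0 (v i)), ← add_assoc]
    refine ih.add ?_
    rw [segment_eq_image']
    exact isCompact_Icc.image (by fun_prop)

theorem convex_add_sum_segment {A : Set E} (hA : Convex ℝ A) (s : Finset ι) (v : ι → E) :
    Convex ℝ (A + ∑ i ∈ s, segment ℝ 0 (v i)) := by
  classical
  induction s using Finset.induction_on with
  | empty => simpa using hA
  | insert i s hi ih =>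
    rw [Finset.sum_insert hi, add_comm (segment ℝ 0 (v i)), ← add_assoc]
    exact ih.add (convex_segment _ _)

theorem sum_segment_subset_submodule {H : Submodule ℝ E} {s : Finset ι} {v : ι → E}
    (h : ∀ i ∈ s, v i ∈ H) : ∑ i ∈ s, segment ℝ 0 (v i) ⊆ H := by
  intro x hx
  obtain ⟨g, hg, rfl⟩ := (Set.mem_finsetSum _ _ _).1 hx
  exact H.sum_mem fun i hi => H.convex.segment_subset H.zero_mem (h i hi) (hg hi)

end Segment

/-! ### Covering counts almost everywhere -/

section Measure

/-- Adding segments `[0, v i]` with `v i` in the subgroup keeps every almost sure symmetry of the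
covering count that agrees, modulo the subgroup, with a multiple of each nonzero `v i`. -/
theorem coverCount_add_sum_segment_add_ae_eq {E ι : Type*} [NormedAddCommGroup E]
    [NormedSpace ℝ E] [MeasurableSpace E] (μ : Measure E) (S : AddSubgroup E) {A : Set E}
    (hA : IsCompact A) (hA' : Convex ℝ A) {s : Finset ι} {v : ι → E} (hv : ∀ i ∈ s, v i ∈ S) {u : E}
    (hu : ∀ i ∈ s, v i ≠ 0 → ∃ t : ℝ, u - t • v i ∈ S)
    (h : ∀ᵐ x ∂μ, coverCount S A (x + u) = coverCount S A x) :
    ∀ᵐ x ∂μ, coverCount S (A + ∑ i ∈ s, segment ℝ 0 (v i)) (x + u)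
      = coverCount S (A + ∑ i ∈ s, segment ℝ 0 (v i)) x := by
  classical
  induction s using Finset.induction_on with
  | empty => simpa using h
  | insert i s hi ih =>
    rw [Finset.sum_insert hi, add_comm (segment ℝ 0 (v i)), ← add_assoc]
    filter_upwards [ih (fun j hj => hv j (Finset.mem_insert_of_mem hj))
      (fun j hj => hu j (Finset.mem_insert_of_mem hj))] with x hx
    rcases eq_or_ne (v i) 0 with h0 | h0
    · rw [h0, segment_same, Set.singleton_zero, add_zero]
      exact hx
    obtain ⟨t, ht⟩ := hu i (Finset.mem_insert_self i s) h0
    exact coverCount_add_segment_add S (convex_add_sum_segment hA' s v)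
      (isCompact_add_sum_segment hA s v).isBounded (hv i (Finset.mem_insert_self i s)) ht hx

variable {E : Type*} [NormedAddCommGroup E] [MeasurableSpace E] [BorelSpace E]

theorem measurable_coverCount {Λ : Set E} (hΛ : Λ.Countable) {K : Set E} (hK : MeasurableSet K) :
    Measurable (coverCount Λ K) := by
  have := hΛ.to_subtype
  exact Measurable.tsum fun l => measurable_const.indicator (hK.const_vadd (l : E))

variable (μ : Measure E)

theorem ae_add_right_iff [μ.IsAddRightInvariant] {p : E → Prop} (u : E) :
    (∀ᵐ x ∂μ, p (x + u)) ↔ ∀ᵐ x ∂μ, p x := by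
  constructor <;> intro h
  · have := (measurePreserving_sub_right μ u).quasiMeasurePreserving.ae h
    simpa using this
  · exact (measurePreserving_add_right μ u).quasiMeasurePreserving.ae h

variable [NormedSpace ℝ E] {ι : Type*} [FiniteDimensional ℝ E] [μ.IsAddHaarMeasure]

theorem coverCount_ae_eq_zero {Λ : Set E} (hΛ : Λ.Countable) {K : Set E} (hK : μ K = 0) :
    ∀ᵐ x ∂μ, coverCount Λ K x = 0 := by
  have := hΛ.to_subtype
  have h : ∀ᵐ x ∂μ, ∀ l : Λ, x ∉ (l : E) +ᵥ K := by
    refine ae_all_iff.2 fun l => ?_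
    refine measure_eq_zero_iff_ae_notMem.1 ?_
    rw [measure_vadd, hK]
  filter_upwards [h] with x hx
  exact ENNReal.tsum_eq_zero.2 fun l => Set.indicator_of_notMem (hx l) _

/-- A measurable function that every translation preserves almost everywhere is almost
everywhere constant. -/
theorem exists_ae_eq_const_of_forall_add_ae_eq {f : E → ℝ≥0∞} (hf : Measurable f)
    (h : ∀ u, ∀ᵐ x ∂μ, f (x + u) = f x) : ∃ c, ∀ᵐ x ∂μ, f x = c := by
  have hm : MeasurableSet {z : E × E | f (z.2 + z.1) = f z.2} :=
    measurableSet_eq_fun (hf.comp (measurable_snd.add measurable_fst)) (hf.comp measurable_snd)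
  have h' : ∀ᵐ x ∂μ, ∀ᵐ u ∂μ, f (x + u) = f x :=
    (Measure.ae_ae_comm hm).1 (Filter.Eventually.of_forall h)
  obtain ⟨x, hx⟩ := h'.exists
  refine ⟨f x, (ae_add_right_iff μ x).1 ?_⟩
  filter_upwards [hx] with u hu
  rw [add_comm, hu]

theorem measure_singleton_add_sum_segment_eq_zero {H : Submodule ℝ E} (hH : H ≠ ⊤) (c : E)
    {s : Finset ι} {v : ι → E} (h : ∀ i ∈ s, v i ∈ H) :
    μ ({c} + ∑ i ∈ s, segment ℝ 0 (v i)) = 0 := by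
  rw [Set.singleton_add, Set.image_add_left, measure_preimage_add]
  exact measure_mono_null (sum_segment_subset_submodule h) (Measure.addHaar_submodule μ H hH)

/-- The translates of a zonotope by a countable subgroup containing its generators cover almost
every point equally often.  Removing one generator leaves, by induction, an almost constant
count, so the count for the whole zonotope is invariant along that generator.  Hence it is
invariant along the span of all generators; if this is a proper subspace, the zonotope is null. -/
theorem exists_coverCount_zonotope_ae_eq_const (S : AddSubgroup E)
    (hS : (S : Set E).Countable) (c : E) (s : Finset ι) {v : ι → E} (hv : ∀ i ∈ s, v i ∈ S) :
    ∃ k, ∀ᵐ x ∂μ, coverCount S ({c} + ∑ i ∈ s, segment ℝ 0 (v i)) x = k := by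
  classical
  induction s using Finset.strongInduction with
  | H s ih =>
    by_cases hspan : Submodule.span ℝ (v '' s) = ⊤
    swap
    · exact ⟨0, coverCount_ae_eq_zero μ hS (measure_singleton_add_sum_segment_eq_zero μ hspan c
        fun i hi => Submodule.subset_span ⟨i, hi, rfl⟩)⟩
    refine exists_ae_eq_const_of_forall_add_ae_eq μ (measurable_coverCount hS
      (isCompact_add_sum_segment isCompact_singleton s v).measurableSet) fun u => ?_
    have hu : u ∈ Submodule.span ℝ (v '' s) := hspan ▸ Submodule.mem_top
    induction hu using Submodule.closure_induction with
    | zero => simp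
    | add y z _ _ hy hz =>
      filter_upwards [hz, (ae_add_right_iff μ z).2 hy] with x hx hx'
      rw [add_comm y z, ← add_assoc, hx', hx]
    | smul_mem t y hy =>
      obtain ⟨i, hi, rfl⟩ := hy
      obtain ⟨k, hk⟩ := ih (s.erase i) (Finset.erase_ssubset hi)
        fun j hj => hv j (Finset.mem_of_mem_erase hj)
      rw [← Finset.sum_erase_add s _ hi, ← add_assoc]
      filter_upwards [hk, (ae_add_right_iff μ (t • v i)).2 hk] with x hx hx'
      exact coverCount_add_segment_add S (convex_add_sum_segment (convex_singleton c) _ v)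
        (isCompact_add_sum_segment isCompact_singleton _ v).isBounded (hv i hi) (t := t)
        (by simp) (hx'.trans hx.symm)

end Measure

/-! ### Lattices adapted to a rational zonotope -/

/-- The lattice `(1 / d) ℤ³`, for `d ≠ 0`; for `d = 0` the defining condition is void. -/
def scaledGrid (d : ℝ) : AddSubgroup E3 where
  carrier := {g | ∀ j, ∃ a : ℤ, d * g j = a}
  zero_mem' j := ⟨0, by simp⟩
  add_mem' {g h} hg hh j := by
    obtain ⟨a, ha⟩ := hg j
    obtain ⟨b, hb⟩ := hh j
    exact ⟨a + b, by simp [mul_add, ha, hb]⟩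
  neg_mem' {g} hg j := by
    obtain ⟨a, ha⟩ := hg j
    exact ⟨-a, by simp [ha]⟩

theorem injOn_floor_scaledGrid {d : ℝ} (hd : d ≠ 0) :
    Set.InjOn (fun (g : E3) (j : Fin 3) => ⌊d * g j⌋) (scaledGrid d : Set E3) := by
  intro g hg h hh he
  ext j
  obtain ⟨a, ha⟩ := hg j
  obtain ⟨b, hb⟩ := hh j
  have := congrFun he j
  simp only [ha, hb, Int.floor_intCast] at this
  exact mul_left_cancel₀ hd (by rw [ha, hb, this])

theorem countable_scaledGrid {d : ℝ} (hd : d ≠ 0) : (scaledGrid d : Set E3).Countable :=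
  Set.countable_of_injective_of_countable_image (injOn_floor_scaledGrid hd) (Set.to_countable _)

theorem isDiscreteSet_of_subset_scaledGrid {d : ℝ} (hd : d ≠ 0) {Λ : Set E3}
    (hΛ : Λ ⊆ scaledGrid d) : IsDiscreteSet Λ := by
  intro x r
  set C : ℤ := ⌈|d| * (‖x‖ + r)⌉
  refine Set.Finite.of_finite_image (f := fun (g : E3) (j : Fin 3) => ⌊d * g j⌋) ?_
    ((injOn_floor_scaledGrid hd).mono fun g hg => hΛ hg.1)
  refine (Set.finite_Icc (fun _ : Fin 3 => -C) (fun _ => C)).subset ?_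
  rintro _ ⟨g, ⟨-, hg⟩, rfl⟩
  have hnorm : ‖g‖ ≤ ‖x‖ + r := norm_le_of_mem_closedBall hg
  have hle : ∀ j, |d * g j| ≤ C := fun j => by
    rw [abs_mul]
    refine le_trans ?_ (Int.le_ceil _)
    gcongr
    exact (PiLp.norm_apply_le g j).trans hnorm
  refine ⟨fun j => ?_, fun j => ?_⟩
  · exact Int.le_floor.2 (by push_cast; exact (abs_le.1 (hle j)).1)
  · have h : ((⌊d * g j⌋ : ℤ) : ℝ) ≤ (C : ℝ) :=
      (Int.floor_le _).trans (abs_le.1 (hle j)).2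
    exact_mod_cast h

theorem exists_int_mul_eq_int_of_isRationalVector {ι : Type*} [Finite ι] {z : ι → E3}
    (hz : ∀ i, IsRationalVector (z i)) :
    ∃ b : ℤ, b ≠ 0 ∧ ∀ i j, ∃ a : ℤ, (b : ℝ) * z i j = a := by
  choose q hq using hz
  obtain ⟨b, hb⟩ := IsLocalization.exist_integer_multiples_of_finite (nonZeroDivisors ℤ)
    (fun x : ι × Fin 3 => q x.1 x.2)
  refine ⟨b, nonZeroDivisors.coe_ne_zero b, fun i j => ?_⟩
  obtain ⟨a, ha⟩ := hb (i, j)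
  refine ⟨a, ?_⟩
  rw [hq]
  have ha' : (a : ℚ) = (b : ℤ) * q i j := by simpa [Submonoid.smul_def] using ha
  exact_mod_cast ha'.symm

/-- Finitely many nonzero vectors are all nonzero under some functional of the form
`(1, B, B ^ 2)`: each rules out only the roots `B` of a nonzero polynomial. -/
theorem exists_nat_forall_apply_ne_zero {ι : Type*} [Finite ι] (z : ι → E3) :
    ∃ B : ℕ, ∀ i, z i ≠ 0 → z i 0 + B * z i 1 + B ^ 2 * z i 2 ≠ 0 := by
  classical
  let f : ι → Polynomial ℝ := fun i =>
    Polynomial.C (z i 0) + Polynomial.C (z i 1) * Polynomial.X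
      + Polynomial.C (z i 2) * Polynomial.X ^ 2
  have hf : ∀ i, z i ≠ 0 → f i ≠ 0 := by
    intro i hi h0
    refine hi ?_
    have h : ∀ n, (f i).coeff n = 0 := by simp [h0]
    have e0 := h 0
    have e1 := h 1
    have e2 := h 2
    simp [f, Polynomial.coeff_X, Polynomial.coeff_C] at e0 e1 e2
    ext j
    fin_cases j <;> simp [e0, e1, e2]
  have hfin : (⋃ i, {B : ℕ | z i ≠ 0 ∧ (f i).IsRoot (B : ℝ)}).Finite := by
    refine Set.finite_iUnion fun i => ?_
    by_cases hi : z i = 0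
    · simp [hi]
    refine Set.Finite.of_finite_image (f := fun B : ℕ => (B : ℝ))
      ((Polynomial.finite_setOfPred_isRoot (hf i hi)).subset ?_) Nat.cast_injective.injOn
    rintro _ ⟨B, hB, rfl⟩
    exact hB.2
  obtain ⟨B, hB⟩ := hfin.infinite_compl.nonempty
  refine ⟨B, fun i hi h => hB (Set.mem_iUnion.2 ⟨i, hi, ?_⟩)⟩
  simp only [f, Polynomial.IsRoot.def, Polynomial.eval_add, Polynomial.eval_mul,
    Polynomial.eval_C, Polynomial.eval_X, Polynomial.eval_pow]
  linarith

/-- A lattice `G` containing given rational vectors, and a vector `r • z i₀ ∉ G` that is congruent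
modulo `G` to a multiple of each nonzero `z i`.  Take an integral functional `φ` that vanishes on
no nonzero `z i` and a prime `p` dividing none of the nonzero integers `φ (z i)`, let `G` be the
part of `(1 / p) ℤ³` (after clearing denominators) on which `φ` is integral, and let
`r = 1 / p`. -/
theorem exists_lattice_forall_sub_smul_mem {ι : Type*} [Finite ι] {z : ι → E3}
    (hz : ∀ i, IsRationalVector (z i)) {i₀ : ι} (hi₀ : z i₀ ≠ 0) :
    ∃ (d r : ℝ) (G : AddSubgroup E3), d ≠ 0 ∧ G ≤ scaledGrid d ∧ r • z i₀ ∈ scaledGrid d ∧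
      (∀ i, z i ∈ G) ∧ r • z i₀ ∉ G ∧ ∀ i, z i ≠ 0 → ∃ t : ℝ, r • z i₀ - t • z i ∈ G := by
  obtain ⟨b, hb0, hb⟩ := exists_int_mul_eq_int_of_isRationalVector hz
  obtain ⟨B, hB⟩ := exists_nat_forall_apply_ne_zero z
  have hb0' : (b : ℝ) ≠ 0 := by exact_mod_cast hb0
  choose a ha using hb
  let φ : E3 →+ ℝ :=
    { toFun := fun g => b * (g 0 + B * g 1 + B ^ 2 * g 2)
      map_zero' := by simp
      map_add' := fun g h => by simp only [PiLp.add_apply]; ring }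
  have hφs : ∀ (t : ℝ) (g : E3), φ (t • g) = t * φ g := fun t g => by
    simp only [φ, AddMonoidHom.coe_mk, ZeroHom.coe_mk, PiLp.smul_apply, smul_eq_mul]
    ring
  let m : ι → ℤ := fun i => a i 0 + B * a i 1 + B ^ 2 * a i 2
  have hm : ∀ i, φ (z i) = m i := fun i => by
    simp only [φ, m, AddMonoidHom.coe_mk, ZeroHom.coe_mk]
    push_cast
    rw [← ha, ← ha, ← ha]
    ring
  have hm0 : ∀ i, z i ≠ 0 → m i ≠ 0 := fun i hi h => by
    have h1 := hm i
    rw [h, Int.cast_zero] at h1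
    exact mul_ne_zero hb0' (hB i hi) h1
  -- A prime larger than every `|m i|`.
  obtain ⟨D, hD⟩ := (Set.finite_range fun i => (m i).natAbs).bddAbove
  obtain ⟨p, hpD, hp⟩ := Nat.exists_infinite_primes (D + 1)
  have hp0 : (p : ℝ) ≠ 0 := by exact_mod_cast hp.ne_zero
  have hpm : ∀ i, z i ≠ 0 → ¬ (p : ℤ) ∣ m i := fun i hi h => by
    have h1 := Nat.le_of_dvd (Int.natAbs_pos.2 (hm0 i hi)) (Int.natCast_dvd.1 h)
    have h2 : (m i).natAbs ≤ D := hD ⟨i, rfl⟩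
    omega
  have hgrid : ∀ (k : ℤ) (i : ι), ((k : ℝ) / p) • z i ∈ scaledGrid (p * b) := fun k i j => by
    refine ⟨k * a i j, ?_⟩
    push_cast
    rw [← ha, PiLp.smul_apply, smul_eq_mul]
    field_simp
  have hgrid₀ : (1 / p : ℝ) • z i₀ ∈ scaledGrid (p * b) := by simpa using hgrid 1 i₀
  refine ⟨p * b, 1 / p, scaledGrid (p * b) ⊓ (Int.castAddHom ℝ).range.comap φ,
    mul_ne_zero hp0 hb0', inf_le_left, hgrid₀, fun i => ⟨?_, m i, (hm i).symm⟩, ?_, ?_⟩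
  · simpa [hp0] using hgrid p i
  · rintro ⟨-, n, hn⟩
    refine hpm i₀ hi₀ ⟨n, ?_⟩
    have hn' : (n : ℝ) = 1 / p * m i₀ := by rw [← hm, ← hφs]; exact hn
    field_simp at hn'
    rw [mul_comm]
    exact_mod_cast hn'.symm
  · intro i hi
    -- `k` solves the congruence `k * m i ≡ m i₀` modulo `p`.
    obtain ⟨x, y, hxy⟩ : IsCoprime (m i) (p : ℤ) :=
      ((Nat.prime_iff_prime_int.1 hp).coprime_iff_not_dvd.2 (hpm i hi)).symm
    refine ⟨((m i₀ * x : ℤ) : ℝ) / p, (scaledGrid _).sub_mem hgrid₀ (hgrid _ i), m i₀ * y, ?_⟩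
    rw [map_sub, hφs, hφs, hm, hm]
    have hxy' : (x : ℝ) * m i + y * p = 1 := by exact_mod_cast hxy
    simp only [Int.coe_castAddHom]
    push_cast
    field_simp
    linear_combination (m i₀ : ℝ) * hxy'

/-! ### The perturbed lattice -/

/-- A finite union of cosets that contains all nonzero multiples of `w` contains `0`: a coset
containing infinitely many multiples of a common period of all those cosets contains `0`. -/
theorem zero_mem_iUnion_vadd_of_forall_zsmul_mem {E ι : Type*} [AddCommGroup E] [Finite ι]
    {L : ι → AddSubgroup E} {t : ι → E} {w : E}
    (h : ∀ n : ℤ, n ≠ 0 → n • w ∈ ⋃ i, t i +ᵥ (L i : Set E)) :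
    (0 : E) ∈ ⋃ i, t i +ᵥ (L i : Set E) := by
  have := Fintype.ofFinite ι
  have hper : ∀ i, ∃ m : ℤ, m ≠ 0 ∧ ((∃ n : ℤ, n ≠ 0 ∧ n • w ∈ L i) → m • w ∈ L i) := by
    intro i
    by_cases hn : ∃ n : ℤ, n ≠ 0 ∧ n • w ∈ L i
    · obtain ⟨n, hn0, hn⟩ := hn
      exact ⟨n, hn0, fun _ => hn⟩
    · exact ⟨1, one_ne_zero, fun h => absurd h hn⟩
  choose m hm0 hm using hper
  have hM : ∏ i, m i ≠ 0 := Finset.prod_ne_zero_iff.2 fun i _ => hm0 i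
  have hmem : ∀ k : ℕ, ∃ i, (((k : ℤ) + 1) * ∏ i, m i) • w ∈ t i +ᵥ (L i : Set E) := fun k =>
    Set.mem_iUnion.1 (h _ (mul_ne_zero (by omega) hM))
  choose i hi using hmem
  obtain ⟨k, l, hkl, hikl⟩ := Finite.exists_ne_map_eq_of_infinite i
  have hk := hi k
  have hl := hi l
  rw [← hikl] at hl
  rw [mem_vadd_set_iff_sub_mem] at hk hl
  -- Two of the multiples lie in the same coset, so their difference is a period.
  have hMw : (∏ i, m i) • w ∈ L (i k) := by
    obtain ⟨c, hc⟩ := Finset.dvd_prod_of_mem m (Finset.mem_univ (i k))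
    rw [hc, mul_comm, mul_smul]
    refine (L (i k)).zsmul_mem (hm (i k) ⟨((k : ℤ) - l) * ∏ i, m i,
      mul_ne_zero (by omega) hM, ?_⟩) c
    have := (L (i k)).sub_mem hk hl
    rwa [sub_sub_sub_cancel_right, ← sub_smul, ← sub_mul, add_sub_add_right_eq_sub] at this
  refine Set.mem_iUnion.2 ⟨i k, mem_vadd_set_iff_sub_mem.2 ?_⟩
  have := (L (i k)).sub_mem hk ((L (i k)).zsmul_mem hMw ((k : ℤ) + 1))
  rwa [← mul_smul, sub_right_comm, sub_self] at this

theorem mainTheorem4 (P : Set E3) (hP : IsRationalTwoFlatZonotope P)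
    (hint : (interior P).Nonempty) :
    ∃ (k : ℕ) (Λ : Set E3), 0 < k ∧ IsTilingAtLevel k P Λ ∧
      ¬ IsFiniteUnionOfTranslatedLattices Λ := by
  obtain ⟨H₁, H₂, hH₁, hH₂, -, n, m, v, w, c, hv, hw, hvq, hwq, rfl⟩ := hP
  have hproper : ∀ H : Submodule ℝ E3, Module.finrank ℝ H = 2 → H ≠ ⊤ := by
    rintro H hH rfl
    simp at hH
  set z := Fin.append v w with hz
  have hP₁ : zonotope c z = {c} + ∑ i, segment ℝ 0 (z i) := by
    rw [zonotope, ← Set.singleton_vadd, vadd_eq_add]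
  have hP₂ : zonotope c z
      = ({c} + ∑ j, segment ℝ 0 (w j)) + ∑ i, segment ℝ 0 (v i) := by
    rw [hP₁, hz, Fin.sum_univ_add, add_assoc]
    simp only [Fin.append_left, Fin.append_right]
    rw [add_comm (∑ i, segment ℝ 0 (v i))]
  set P := zonotope c z with hPdef
  have hpos : 0 < volume P := Measure.measure_pos_of_nonempty_interior _ hint
  have hcpt : IsCompact P := hP₁ ▸ isCompact_add_sum_segment isCompact_singleton _ _
  have hzq : ∀ i, IsRationalVector (z i) :=
    Fin.addCases (fun i => by simpa [hz] using hvq i) (fun j => by simpa [hz] using hwq j)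
  have hspan : ∀ H : Submodule ℝ E3, H ≠ ⊤ → ¬ ∀ i, z i ∈ H := fun H hH h =>
    hpos.ne' (hP₁ ▸ measure_singleton_add_sum_segment_eq_zero volume hH c fun i _ => h i)
  obtain ⟨i₀, hi₀⟩ : ∃ i, v i ≠ 0 := by
    by_contra! h
    exact hspan H₂ (hproper H₂ hH₂) (Fin.addCases (fun i => by simp [hz, h i])
      (fun j => by simpa [hz] using hw j))
  obtain ⟨j₀, hj₀⟩ : ∃ j, w j ∉ H₁ := by
    by_contra! h
    exact hspan H₁ (hproper H₁ hH₁) (Fin.addCases (fun i => by simpa [hz] using hv i)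
      (fun j => by simpa [hz] using h j))
  obtain ⟨d, r, G, hd, hGd, hud, hzG, huG, hu⟩ :=
    exists_lattice_forall_sub_smul_mem hzq (i₀ := Fin.castAdd m i₀) (by simpa [hz] using hi₀)
  have hvG : ∀ i, v i ∈ G := fun i => by simpa [hz] using hzG (Fin.castAdd m i)
  have hwG : ∀ j, w j ∈ G := fun j => by simpa [hz] using hzG (Fin.natAdd n j)
  replace hu : ∀ i, v i ≠ 0 → ∃ t : ℝ, r • v i₀ - t • v i ∈ G := fun i hi => by
    simpa [hz] using hu (Fin.castAdd m i) (by simpa [hz] using hi)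
  simp only [hz, Fin.append_left] at hud huG
  set u := r • v i₀
  have huH : u ∈ H₁ := H₁.smul_mem r (hv i₀)
  set S : AddSubgroup E3 := G ⊓ H₁.toAddSubgroup with hS
  have hGc : (G : Set E3).Countable := (countable_scaledGrid hd).mono hGd
  have hSc : (S : Set E3).Countable := hGc.mono fun g hg => hg.1
  have hGS : (G : Set E3) \ S ∪ S = G := Set.sdiff_union_of_subset fun g hg => hg.1
  have hdisj : Disjoint (u +ᵥ (S : Set E3)) G := by
    refine Set.disjoint_left.2 fun g hg hgG => huG ?_
    rw [mem_vadd_set_iff_sub_mem] at hg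
    simpa using G.sub_mem hgG hg.1
  -- The covering count of the planar lattice `S` is invariant under the translation by `u`.
  have hSu : ∀ᵐ x, coverCount S P (x + u) = coverCount S P x := by
    have hnull : ∀ᵐ x, coverCount S ({c} + ∑ j, segment ℝ 0 (w j)) x = 0 :=
      coverCount_ae_eq_zero volume hSc (measure_singleton_add_sum_segment_eq_zero volume
        (hproper H₂ hH₂) c fun j _ => hw j)
    rw [hP₂]
    refine coverCount_add_sum_segment_add_ae_eq volume S
      (isCompact_add_sum_segment isCompact_singleton _ _)
      (convex_add_sum_segment (convex_singleton c) _ _) (fun i _ => ⟨hvG i, hv i⟩)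
      (fun i _ hi => ?_) ?_
    · obtain ⟨t, ht⟩ := hu i hi
      exact ⟨t, ht, H₁.sub_mem huH (H₁.smul_mem t (hv i))⟩
    · filter_upwards [hnull, (ae_add_right_iff volume u).2 hnull] with x hx hx'
      rw [hx, hx']
  obtain ⟨k, hk⟩ : ∃ k, ∀ᵐ x, coverCount G P x = k := by
    rw [hP₁]
    exact exists_coverCount_zonotope_ae_eq_const volume G hGc c _ fun i _ => hzG i
  -- `P` has positive measure, so one of its points is covered `k` times; this shows that `k` is
  -- finite, because `G` is discrete, and positive, because `0 ∈ G`.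
  obtain ⟨x, hxP, hxk⟩ : ∃ x ∈ P, coverCount G P x = k := by
    by_contra! h
    exact hpos.ne' (measure_mono_null (fun x hx => h x hx) (ae_iff.1 hk))
  have hfin : {l | l ∈ (G : Set E3) ∧ x - l ∈ P}.Finite := by
    obtain ⟨R, hR⟩ := hcpt.isBounded.exists_norm_le
    refine (isDiscreteSet_of_subset_scaledGrid hd hGd x R).subset fun l hl => ⟨hl.1, ?_⟩
    rw [Metric.mem_closedBall, dist_comm, dist_eq_norm]
    exact hR _ hl.2
  have hkn : k = ({l | l ∈ (G : Set E3) ∧ x - l ∈ P}.ncard : ℝ≥0∞) := by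
    rw [← hxk, coverCount_eq_encard, ← hfin.cast_ncard_eq, ENat.toENNReal_coe]
  refine ⟨{l | l ∈ (G : Set E3) ∧ x - l ∈ P}.ncard, (G : Set E3) \ S ∪ (u +ᵥ (S : Set E3)),
    (Set.ncard_pos hfin).2 ⟨0, G.zero_mem, by simpa using hxP⟩, ⟨?_, ?_⟩, ?_⟩
  · refine isDiscreteSet_of_subset_scaledGrid hd (Set.union_subset (fun g hg => hGd hg.1) ?_)
    intro g hg
    rw [mem_vadd_set_iff_sub_mem] at hg
    simpa using (scaledGrid d).add_mem (hGd hg.1) hud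
  · have hSu' : ∀ᵐ x, coverCount S P (x - u) = coverCount S P x := by
      refine (ae_add_right_iff volume u).1 ?_
      filter_upwards [hSu] with x hx
      rw [add_sub_cancel_right, hx]
    filter_upwards [hk, hSu'] with y hy hy'
    change coverCount _ P y = _
    rw [coverCount_union (hdisj.symm.mono_left Set.sdiff_subset), coverCount_vadd, hy',
      ← coverCount_union Set.disjoint_sdiff_left, hGS, hy, hkn]
  · rintro ⟨N, L, t, -, hΛ⟩
    -- The line through `w j₀` meets the set in exactly the nonzero multiples of `w j₀`.
    have h0 : (0 : E3) ∈ (G : Set E3) \ S ∪ (u +ᵥ (S : Set E3)) := by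
      rw [hΛ]
      refine zero_mem_iUnion_vadd_of_forall_zsmul_mem (w := w j₀) fun a ha => ?_
      rw [← hΛ]
      refine Or.inl ⟨G.zsmul_mem (hwG j₀) a, fun h => hj₀ ?_⟩
      have h2 : (a : ℝ) • w j₀ ∈ H₁ := by
        rw [Int.cast_smul_eq_zsmul]
        exact h.2
      exact (H₁.smul_mem_iff (by exact_mod_cast ha)).1 h2
    rcases h0 with h0 | h0
    · exact h0.2 S.zero_mem
    · exact Set.disjoint_left.1 hdisj h0 G.zero_mem
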